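/- For a finite simple graph $G$, let $i_t(G)$ denote the number of independent sets of $G$ with exactly $t$ vertices. Call $G$ $k$-chromatic if its chromatic number is exactly $k$, and $\ell$-connected if $|V(G)|>\ell$ and every graph obtained from $G$ by deleting fewer than $\ell$ vertices is connected. Write $K_m$ and $E_m$ for the complete and the empty (edgeless) graph on $m$ vertices, $\cup$ for disjoint union, and $G_1\vee G_2$ for the join, that is, the disjoint union of $G_1$ and $G_2$ together with all edges between $V(G_1)$ and $V(G_2)$. Theorem. Let $k\ge 3$, $\ell\ge k$ and $n\ge 2\ell$ be integers, and let $G^*=(K_{k-1}\cup E_{\ell-k+1})\vee E_{n-\ell}$. If $G$ is an $n$-vertex $k$-chromatic $\ell$-connected graph and $t\ge\ell$ is an integer, then $$i_t(G)\le i_t(G^*).$$ -/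

import Mathlib

namespace IndepCount

/-- The join `G ∨ H`: the disjoint union of `G` and `H` together with all edges between them. -/
def join {V W : Type*} (G : SimpleGraph V) (H : SimpleGraph W) : SimpleGraph (V ⊕ W) :=
  (G ⊕g H) ⊔ completeBipartiteGraph V W

/-- `i_t(G)`: the number of independent sets of size `t` in the finite graph `G`. -/
noncomputable def indepCount {V : Type*} [Fintype V] (G : SimpleGraph V) (t : ℕ) : ℕ :=
  (G.indepSetSet t).ncard

/-- `G` is `l`-connected: it has more than `l` vertices, and any graph obtained by deleting
fewer than `l` vertices is connected. -/
def IsVertexConnected {V : Type*} [Fintype V] (G : SimpleGraph V) (l : ℕ) : Prop :=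
  l < Fintype.card V ∧
    ∀ S : Finset V, S.card < l → (G.induce ((S : Set V)ᶜ)).Connected

/-- The graph `G* = (K_{k-1} ∪ E_{l-k+1}) ∨ E_{n-l}`, for `1 ≤ k ≤ l ≤ n`. Under these
inequalities no subtraction truncates and `G*` has `n` vertices. -/
def extremalGraph (n k l : ℕ) :
    SimpleGraph ((Fin (k - 1) ⊕ Fin (l - k + 1)) ⊕ Fin (n - l)) :=
  join ((⊤ : SimpleGraph (Fin (k - 1))) ⊕g (⊥ : SimpleGraph (Fin (l - k + 1))))
    (⊥ : SimpleGraph (Fin (n - l)))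

end IndepCount

namespace IndepCount

section Counting

set_option linter.unusedSectionVars false

open scoped Classical
open Finset

variable {V : Type*} [Fintype V]

/-! Connectivity enters only through minimum degree at least `l`, and `G*` has at least C(n-l, t)
independent `t`-sets inside `E_{n-l}`. So the goal is the bound C(n-l, t) for graphs of minimum
degree at least `l`; when t = l these must not be bipartite, since K_{l,n-l} with n > 2l exceeds the
bound by one.

Put t = m + 1, so that t · i_t is the sum of the link sizes, and let `x` have the largest link, g =
|good|, b = |bad|, f = |far x|. Suppose deg x = l. Then t · C(n-l, t) = (f+1)(g+b), while the f+1
vertices outside N(x) contribute at most (f+1)g. The links of the neighbours of `x` must therefore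
be paid for by bad sets, at a cost of at most (f+1)b. Members of these links lying in far x, or
meeting both N(x) and far x, cost at most f·b (`sum_card_extenders_le`). This rests on two
injections into bad sets: exchanging members of N(x) for neighbours of some y in far x
(`card_le_card_bad_filter`), possible because deg y ≥ deg x, and swapping one vertex of a good set
(`sum_card_reach_le`). Members inside N(x) matter only for t = l, where they force N(x) to be
independent; non-bipartiteness then supplies a bad set.

If deg x > l, then f is smaller and the bound n·g suffices, except when t = l and deg x = l + 1,
where it is averaged with a cruder version of the same count. -/

/-- A finset of vertices spanning no edge. -/
def Indep (G : SimpleGraph V) (s : Finset V) : Prop :=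
  ∀ a ∈ s, ∀ b ∈ s, ¬ G.Adj a b

/-- The neighbourhood of `v`. -/
noncomputable def nb (G : SimpleGraph V) (v : V) : Finset V := univ.filter fun w => G.Adj v w

/-- The vertices other than `v` that are not adjacent to `v`. -/
noncomputable def far (G : SimpleGraph V) (v : V) : Finset V :=
  univ.filter fun w => w ≠ v ∧ ¬ G.Adj v w

/-- The `m`-sets which together with `v` form an independent set of size `m + 1`. -/
noncomputable def link (G : SimpleGraph V) (m : ℕ) (v : V) : Finset (Finset V) :=
  univ.filter fun J => J.card = m ∧ v ∉ J ∧ Indep G (insert v J)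

/-- The independent `m`-sets of non-neighbours of `x`. -/
noncomputable def good (G : SimpleGraph V) (m : ℕ) (x : V) : Finset (Finset V) :=
  ((far G x).powersetCard m).filter fun W => Indep G W

/-- The `m`-sets of non-neighbours of `x` that are not independent. -/
noncomputable def bad (G : SimpleGraph V) (m : ℕ) (x : V) : Finset (Finset V) :=
  ((far G x).powersetCard m).filter fun W => ¬ Indep G W

/-! ### Links and double counting -/

variable {G : SimpleGraph V} {m : ℕ} {x y : V}

@[simp] lemma mem_nb {v w : V} : w ∈ nb G v ↔ G.Adj v w := by simp [nb]

@[simp] lemma mem_far {v w : V} : w ∈ far G v ↔ w ≠ v ∧ ¬ G.Adj v w := by simp [far]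

lemma mem_link {J : Finset V} {v : V} :
    J ∈ link G m v ↔ J.card = m ∧ v ∉ J ∧ Indep G (insert v J) := by simp [link]

lemma mem_good {W : Finset V} : W ∈ good G m x ↔ (W ⊆ far G x ∧ W.card = m) ∧ Indep G W := by
  simp [good, mem_powersetCard]

lemma mem_bad {W : Finset V} : W ∈ bad G m x ↔ (W ⊆ far G x ∧ W.card = m) ∧ ¬ Indep G W := by
  simp [bad, mem_powersetCard]

lemma Indep.mono {s t : Finset V} (ht : Indep G t) (h : s ⊆ t) : Indep G s :=
  fun a ha b hb => ht a (h ha) b (h hb)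

lemma Indep.insert {s : Finset V} {v : V} (hs : Indep G s) (h : ∀ w ∈ s, ¬ G.Adj v w) :
    Indep G (insert v s) := by
  intro a ha b hb hab
  rw [mem_insert] at ha hb
  rcases ha with rfl | ha <;> rcases hb with rfl | hb
  · exact G.irrefl hab
  · exact h b hb hab
  · exact h a ha hab.symm
  · exact hs a ha b hb hab

lemma card_far_add (x : V) : (far G x).card + (nb G x).card + 1 = Fintype.card V := by
  have h1 : Disjoint (far G x) (nb G x) := by
    rw [disjoint_left]; intro a ha hb; simp at ha hb; exact ha.2 hb
  have h2 : x ∉ far G x ∪ nb G x := by simp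
  rw [← card_union_of_disjoint h1, ← card_insert_of_notMem h2, ← card_univ]
  congr 1
  ext a
  simp only [mem_insert, mem_union, mem_far, mem_nb, mem_univ, iff_true]
  tauto

lemma link_eq_good (x : V) : link G m x = good G m x := by
  ext J
  rw [mem_link, mem_good]
  constructor
  · rintro ⟨h1, h2, h3⟩
    refine ⟨⟨fun a ha => mem_far.2 ⟨fun h => h2 (h ▸ ha), ?_⟩, h1⟩, h3.mono (subset_insert _ _)⟩
    exact h3 x (mem_insert_self _ _) a (mem_insert_of_mem ha)
  · rintro ⟨⟨h1, h2⟩, h3⟩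
    exact ⟨h2, fun h => (mem_far.1 (h1 h)).1 rfl, h3.insert fun w hw => (mem_far.1 (h1 hw)).2⟩

lemma card_good_add_card_bad (m : ℕ) (x : V) :
    (good G m x).card + (bad G m x).card = (far G x).card.choose m := by
  rw [good, bad, card_filter_add_card_filter_not, card_powersetCard]

/-- Double counting of pairs consisting of an independent `(m+1)`-set and one of its vertices. -/
lemma sum_card_link (G : SimpleGraph V) (m : ℕ) :
    ∑ v, (link G m v).card =
      (m + 1) * (univ.filter fun I : Finset V => I.card = m + 1 ∧ Indep G I).card := by
  set 𝓘 := univ.filter fun I : Finset V => I.card = m + 1 ∧ Indep G I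
  have h1 : ∀ v, (link G m v).card = (𝓘.filter fun I => v ∈ I).card := by
    intro v
    refine card_bij' (fun J _ => insert v J) (fun I _ => I.erase v) ?_ ?_ ?_ ?_
    · intro J hJ
      obtain ⟨a, b, c⟩ := mem_link.1 hJ
      simp [𝓘, card_insert_of_notMem b, a, c]
    · intro I hI
      simp only [𝓘, mem_filter, mem_univ, true_and] at hI
      refine mem_link.2 ⟨?_, notMem_erase _ _, ?_⟩
      · rw [card_erase_of_mem hI.2, hI.1.1]; rfl
      · rw [insert_erase hI.2]; exact hI.1.2
    · intro J hJ
      exact erase_insert (mem_link.1 hJ).2.1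
    · intro I hI
      exact insert_erase (mem_filter.1 hI).2
  simp_rw [h1]
  have h2 := sum_card_bipartiteAbove_eq_sum_card_bipartiteBelow
    (s := (univ : Finset V)) (t := 𝓘) (fun v I => v ∈ I)
  simp only [bipartiteAbove, bipartiteBelow] at h2
  rw [h2, sum_congr rfl (g := fun _ => m + 1), sum_const, smul_eq_mul, mul_comm]
  intro I hI
  simp only [𝓘, mem_filter] at hI
  simp [hI.2.1]

/-! ### The exchange at a non-neighbour of `x` -/

/-- Replacing the members of `A ⊆ N(x)` by neighbours of `y` outside `N(x)`. -/
lemma card_le_card_bad_filter (hy : y ∈ far G x) {A : Finset V} (hA : A ⊆ nb G x)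
    (hc : A.card ≤ ((far G x).filter fun w => G.Adj y w).card)
    (P : Finset V → Prop) (F : Finset (Finset V))
    (hF : ∀ J ∈ F, J.card = m ∧ y ∈ J ∧ J ⊆ A ∪ far G x ∧ Indep G (J ∩ far G x) ∧
      (J ∩ A).Nonempty ∧ P (J ∩ far G x)) :
    F.card ≤ ((bad G m x).filter fun W =>
      y ∈ W ∧ Indep G (W \ nb G y) ∧ P (W \ nb G y)).card := by
  set C := (far G x).filter fun w => G.Adj y w
  obtain ⟨e⟩ : Nonempty (A ↪ C) :=
    Function.Embedding.nonempty_of_card_le (by simpa using hc)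
  set φ : V → V := fun v => if h : v ∈ A then e ⟨v, h⟩ else v
  have hφA : ∀ v ∈ A, φ v ∈ C := by
    intro v hv
    simp only [φ, hv, dif_pos]
    exact (e ⟨v, hv⟩).2
  have hφn : ∀ v, v ∉ A → φ v = v := fun v hv => by simp [φ, hv]
  have hφi : ∀ v ∈ A, ∀ w ∈ A, φ v = φ w → v = w := by
    intro v hv w hw h
    simp only [φ, hv, hw, dif_pos] at h
    have := e.injective (Subtype.ext h)
    simpa using this
  have hAfar : ∀ v ∈ A, v ∉ far G x := fun v hv h => (mem_far.1 h).2 (mem_nb.1 (hA hv))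
  have hCadj : ∀ v ∈ C, v ∈ far G x ∧ G.Adj y v := fun v hv => mem_filter.1 hv
  have hrest : ∀ J ∈ F, ∀ w ∈ J, w ∉ A → w ∈ far G x ∧ ¬ G.Adj y w := by
    intro J hJ w hw hwA
    obtain ⟨-, h2, h3, h4, -⟩ := hF J hJ
    have hwf : w ∈ far G x := (mem_union.1 (h3 hw)).resolve_left hwA
    exact ⟨hwf, h4 y (mem_inter.2 ⟨h2, hy⟩) w (mem_inter.2 ⟨hw, hwf⟩)⟩
  have hsep : ∀ J ∈ F, ∀ v ∈ A, ∀ w ∈ J, φ v = φ w → v = w := by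
    intro J hJ v hv w hw h
    by_cases hwA : w ∈ A
    · exact hφi v hv w hwA h
    · have h1 := (hCadj _ (hφA v hv)).2
      rw [h, hφn w hwA] at h1
      exact absurd h1 (hrest J hJ w hw hwA).2
  have hinj : ∀ J ∈ F, Set.InjOn φ J := by
    intro J hJ v hv w hw h
    by_cases hvA : v ∈ A
    · exact hsep J hJ v hvA w hw h
    by_cases hwA : w ∈ A
    · exact (hsep J hJ w hwA v hv h.symm).symm
    · rwa [hφn v hvA, hφn w hwA] at h
  -- The new vertices are all neighbours of `y` and the kept ones are not, so deleting N(y) recovers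
  -- the part of `J` in far x; injectivity rests on this.
  have hcore : ∀ J ∈ F, J.image φ \ nb G y = J ∩ far G x := by
    intro J hJ
    ext a
    simp only [mem_sdiff, mem_image, mem_nb, mem_inter]
    constructor
    · rintro ⟨⟨v, hv, rfl⟩, ha⟩
      by_cases hvA : v ∈ A
      · exact absurd (hCadj _ (hφA v hvA)).2 ha
      · rw [hφn v hvA]
        exact ⟨hv, (hrest J hJ v hv hvA).1⟩
    · rintro ⟨ha, haf⟩
      have haA : a ∉ A := fun h => hAfar a h haf
      exact ⟨⟨a, ha, hφn a haA⟩, (hrest J hJ a ha haA).2⟩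
  refine card_le_card_of_injOn (fun J => J.image φ) ?_ ?_
  · intro J hJ
    obtain ⟨h1, h2, h3, h4, ⟨v, hv⟩, h6⟩ := hF J hJ
    have hyA : y ∉ A := fun h => hAfar y h hy
    have hyW : y ∈ J.image φ := mem_image.2 ⟨y, h2, hφn y hyA⟩
    simp only [coe_filter, Set.mem_ofPred_eq]
    refine ⟨mem_bad.2 ⟨⟨?_, ?_⟩, ?_⟩, hyW, ?_, ?_⟩
    · intro a ha
      obtain ⟨v, hv, rfl⟩ := mem_image.1 ha
      by_cases hvA : v ∈ A
      · exact (hCadj _ (hφA v hvA)).1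
      · rw [hφn v hvA]; exact (hrest J hJ v hv hvA).1
    · rw [card_image_of_injOn (hinj J hJ), h1]
    · intro h
      rw [mem_inter] at hv
      exact h y hyW (φ v) (mem_image_of_mem _ hv.1) (hCadj _ (hφA v hv.2)).2
    · rw [hcore J hJ]; exact h4
    · rw [hcore J hJ]; exact h6
  · intro J hJ K hK h
    have key : ∀ J ∈ F, ∀ K ∈ F, J.image φ = K.image φ → J ⊆ K := by
      intro J hJ K hK h v hv
      by_cases hvA : v ∈ A
      · have : φ v ∈ K.image φ := h ▸ mem_image_of_mem _ hv
        obtain ⟨w, hw, hvw⟩ := mem_image.1 this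
        rwa [hsep K hK v hvA w hw hvw.symm]
      · have h1 : v ∈ J ∩ far G x := mem_inter.2 ⟨hv, (hrest J hJ v hv hvA).1⟩
        rw [← hcore J hJ, h, hcore K hK] at h1
        exact (mem_inter.1 h1).1
    exact (key J hJ K hK h).antisymm (key K hK J hJ h.symm)

/-- Cancel the common neighbours from deg x ≤ deg y + c. With c = 0 this is the room the exchange at
`y` needs. -/
lemma card_nb_sdiff_le {l c : ℕ} (hy : y ∈ far G x) (hl : l ≤ (nb G y).card)
    (hx : (nb G x).card ≤ l + c) :
    (nb G x \ nb G y).card ≤ ((far G x).filter fun w => G.Adj y w).card + c := by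
  have h1 : (nb G y).card ≤
      ((far G x).filter fun w => G.Adj y w).card + (nb G x ∩ nb G y).card := by
    refine (card_le_card ?_).trans (card_union_le _ _)
    intro a ha
    rw [mem_nb] at ha
    have hax : a ≠ x := fun h => (mem_far.1 hy).2 (h ▸ ha.symm)
    by_cases h : G.Adj x a <;> simp [ha, h, hax]
  have h2 := card_sdiff_add_card_inter (nb G x) (nb G y)
  omega

/-! ### Good sets extended by a neighbour of `x` -/

/-- The members of `N(x)` that extend `T`. -/
noncomputable def extenders (G : SimpleGraph V) (x : V) (T : Finset V) : Finset V :=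
  (nb G x).filter fun u => u ∉ T ∧ Indep G (insert u T)

lemma sum_card_link_filter_far (G : SimpleGraph V) (m : ℕ) (x : V) :
    ∑ u ∈ nb G x, ((link G m u).filter fun J => J ⊆ far G x).card =
      ∑ T ∈ good G m x, (extenders G x T).card := by
  have h := sum_card_bipartiteAbove_eq_sum_card_bipartiteBelow
    (s := nb G x) (t := good G m x) (fun u T => u ∉ T ∧ Indep G (insert u T))
  simp only [bipartiteAbove, bipartiteBelow] at h
  unfold extenders
  rw [← h]
  refine sum_congr rfl fun u hu => ?_
  congr 1
  ext J
  simp only [mem_filter, mem_link, mem_good]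
  constructor
  · rintro ⟨⟨a, b, c⟩, d⟩
    exact ⟨⟨⟨d, a⟩, c.mono (subset_insert _ _)⟩, b, c⟩
  · rintro ⟨⟨⟨d, a⟩, -⟩, b, c⟩
    exact ⟨⟨a, b, c⟩, d⟩

/-- The vertices of `W` that may be exchanged for `b` to give an independent set. -/
noncomputable def swaps (G : SimpleGraph V) (W : Finset V) (b : V) : Finset V :=
  W.filter fun r => Indep G (insert b (W.erase r))

/-- The non-neighbours of `x` outside `T` with a neighbour in `T` other than `b`. -/
noncomputable def reach (G : SimpleGraph V) (x : V) (T : Finset V) (b : V) : Finset V :=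
  (far G x \ T).filter fun r => ∃ z ∈ T.erase b, G.Adj z r

/-- Send (T, b, r) to (T - b + r, b, r). The new set is bad because `r` has a neighbour in T - b,
and swapping `r` back for `b` recovers T. -/
lemma sum_card_reach_le (G : SimpleGraph V) (m : ℕ) (x : V) :
    ∑ T ∈ good G m x, ∑ b ∈ T, (reach G x T b).card ≤
      ∑ W ∈ bad G m x, ∑ b ∈ far G x \ W, (swaps G W b).card := by
  have h1 : ∑ T ∈ good G m x, ∑ b ∈ T, (reach G x T b).card =
      ((good G m x).sigma fun T => T.sigma fun b => reach G x T b).card := by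
    simp [card_sigma]
  have h2 : ∑ W ∈ bad G m x, ∑ b ∈ far G x \ W, (swaps G W b).card =
      ((bad G m x).sigma fun W => (far G x \ W).sigma fun b => swaps G W b).card := by
    simp [card_sigma]
  rw [h1, h2]
  refine card_le_card_of_injOn
    (fun p => ⟨insert p.2.2 (p.1.erase p.2.1), ⟨p.2.1, p.2.2⟩⟩) ?_ ?_
  · rintro ⟨T, b, r⟩ hp
    simp only [coe_sigma, Set.mem_sigma_iff, mem_coe, reach, mem_filter, mem_sdiff] at hp
    obtain ⟨hT, hb, ⟨hr, hrT⟩, z, hz, hzr⟩ := hp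
    obtain ⟨⟨hTf, hTm⟩, hTi⟩ := mem_good.1 hT
    have hrb : r ≠ b := fun h => hrT (h ▸ hb)
    have hre : r ∉ T.erase b := fun h => hrT (mem_of_mem_erase h)
    simp only [coe_sigma, Set.mem_sigma_iff, mem_coe, swaps, mem_filter, mem_sdiff]
    refine ⟨mem_bad.2 ⟨⟨?_, ?_⟩, ?_⟩, ⟨hTf hb, ?_⟩, mem_insert_self _ _, ?_⟩
    · exact insert_subset hr ((erase_subset _ _).trans hTf)
    · rw [card_insert_of_notMem hre, card_erase_add_one hb, hTm]
    · intro h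
      exact h z (mem_insert_of_mem hz) r (mem_insert_self _ _) hzr
    · simp [hrb.symm]
    · rw [erase_insert hre, insert_erase hb]; exact hTi
  · rintro ⟨T, b, r⟩ hp ⟨T', b', r'⟩ hp' h
    simp only [coe_sigma, Set.mem_sigma_iff, mem_coe, reach, mem_filter, mem_sdiff] at hp hp'
    obtain ⟨hT, hb, ⟨hr, hrT⟩, -⟩ := hp
    obtain ⟨hT', hb', ⟨hr', hrT'⟩, -⟩ := hp'
    simp only [Sigma.mk.injEq] at h
    obtain ⟨h1, h2⟩ := h
    obtain ⟨rfl, h3⟩ := Sigma.mk.inj (eq_of_heq h2)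
    obtain rfl := eq_of_heq h3
    have hre : r ∉ T.erase b := fun h => hrT (mem_of_mem_erase h)
    have hre' : r ∉ T'.erase b := fun h => hrT' (mem_of_mem_erase h)
    have h4 : T.erase b = T'.erase b := by
      rw [← erase_insert hre, ← erase_insert hre', h1]
    have h5 : T = T' := by rw [← insert_erase hb, h4, insert_erase hb']
    rw [h5]

/-- Pick z ≠ b in T, which needs m ≥ 2. Extenders avoid N(z), and every neighbour of `z` in far x
lies in `reach`. -/
lemma card_extenders_le {l c : ℕ} (hdeg : ∀ v, l ≤ (nb G v).card)
    (hx : (nb G x).card ≤ l + c) (hm : 2 ≤ m) {T : Finset V} (hT : T ∈ good G m x)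
    {b : V} (hb : b ∈ T) : (extenders G x T).card ≤ (reach G x T b).card + c := by
  obtain ⟨⟨hTf, hTm⟩, hTi⟩ := mem_good.1 hT
  obtain ⟨z, hz⟩ : (T.erase b).Nonempty := by
    rw [← card_pos, card_erase_of_mem hb]; omega
  have hzT := mem_of_mem_erase hz
  calc (extenders G x T).card ≤ (nb G x \ nb G z).card := by
        refine card_le_card fun u hu => ?_
        simp only [extenders, mem_filter, mem_nb] at hu
        simp only [mem_sdiff, mem_nb]
        exact ⟨hu.1, fun h => hu.2.2 z (mem_insert_of_mem hzT) u (mem_insert_self _ _) h⟩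
    _ ≤ ((far G x).filter fun w => G.Adj z w).card + c :=
        card_nb_sdiff_le (hTf hzT) (hdeg z) hx
    _ ≤ (reach G x T b).card + c := by
        gcongr
        intro r hr
        simp only [mem_filter] at hr
        simp only [reach, mem_filter, mem_sdiff]
        exact ⟨⟨hr.1, fun h => hTi z hzT r h hr.2⟩, z, hz, hr.2⟩

/-- The vertex removed must be an end of any fixed edge inside `W`. -/
lemma card_swaps_le_two {W : Finset V} (hW : ¬ Indep G W) (b : V) :
    (swaps G W b).card ≤ 2 := by
  simp only [Indep, not_forall, not_not] at hW
  obtain ⟨p, hp, q, hq, hpq⟩ := hW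
  refine (card_le_card (t := {p, q}) ?_).trans card_le_two
  intro r hr
  simp only [swaps, mem_filter] at hr
  by_contra h
  simp only [mem_insert, mem_singleton, not_or] at h
  exact hr.2 p (mem_insert_of_mem (mem_erase.2 ⟨Ne.symm h.1, hp⟩)) q
    (mem_insert_of_mem (mem_erase.2 ⟨Ne.symm h.2, hq⟩)) hpq

/-! ### Mixed sets -/

/-- The independent `m`-sets avoiding `x` that meet both `N(x)` and its complement. -/
noncomputable def mixed (G : SimpleGraph V) (m : ℕ) (x : V) : Finset (Finset V) :=
  univ.filter fun J => J.card = m ∧ Indep G J ∧ J ⊆ nb G x ∪ far G x ∧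
    (J ∩ nb G x).Nonempty ∧ (J ∩ far G x).Nonempty

lemma mem_mixed {J : Finset V} : J ∈ mixed G m x ↔ J.card = m ∧ Indep G J ∧
    J ⊆ nb G x ∪ far G x ∧ (J ∩ nb G x).Nonempty ∧ (J ∩ far G x).Nonempty := by
  simp [mixed]

lemma subset_of_mem_link {u : V} (hu : G.Adj x u) {J : Finset V} (hJ : J ∈ link G m u) :
    J ⊆ nb G x ∪ far G x := by
  intro a ha
  have hax : a ≠ x := fun h => (mem_link.1 hJ).2.2 a (mem_insert_of_mem ha) u
    (mem_insert_self _ _) (h ▸ hu)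
  by_cases h : G.Adj x a <;> simp [h, hax]

lemma card_link_le {u : V} (hu : G.Adj x u) :
    (link G m u).card ≤ ((link G m u).filter fun J => J ⊆ far G x).card +
      ((link G m u).filter fun J => J ⊆ nb G x).card +
      ((mixed G m x).filter fun J => u ∉ J ∧ Indep G (insert u J)).card := by
  refine (card_le_card ?_).trans ((card_union_le _ _).trans
    (Nat.add_le_add_right (card_union_le _ _) _))
  intro J hJ
  have hs := subset_of_mem_link hu hJ
  obtain ⟨h1, h2, h3⟩ := mem_link.1 hJ
  simp only [mem_union, mem_filter, hJ, true_and]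
  by_cases hf : J ⊆ far G x
  · exact Or.inl (Or.inl hf)
  by_cases hn : J ⊆ nb G x
  · exact Or.inl (Or.inr hn)
  right
  obtain ⟨a, ha, haf⟩ := not_subset.1 hf
  obtain ⟨b, hb, hbn⟩ := not_subset.1 hn
  refine ⟨mem_mixed.2 ⟨h1, h3.mono (subset_insert _ _), hs, ⟨a, ?_⟩, ⟨b, ?_⟩⟩, h2, h3⟩
  · exact mem_inter.2 ⟨ha, (mem_union.1 (hs ha)).resolve_right haf⟩
  · exact mem_inter.2 ⟨hb, (mem_union.1 (hs hb)).resolve_left hbn⟩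

lemma sum_card_mixed_filter (G : SimpleGraph V) (m : ℕ) (x : V) :
    ∑ u ∈ nb G x, ((mixed G m x).filter fun J => u ∉ J ∧ Indep G (insert u J)).card =
      ∑ J ∈ mixed G m x, (extenders G x J).card := by
  have h := sum_card_bipartiteAbove_eq_sum_card_bipartiteBelow
    (s := nb G x) (t := mixed G m x) (fun u T => u ∉ T ∧ Indep G (insert u T))
  simpa only [bipartiteAbove, bipartiteBelow, extenders] using h

/-- For each `y` the exchange injects the members of `F` through `y` into the bad sets through `y`;
each bad set is counted once per element, hence `m` times. -/
lemma sum_card_inter_far_le {F : Finset (Finset V)} (hF : F ⊆ mixed G m x)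
    (hA : ∀ y ∈ far G x, (∃ J ∈ F, y ∈ J) → ∃ A ⊆ nb G x,
      A.card ≤ ((far G x).filter fun w => G.Adj y w).card ∧
      ∀ J ∈ F, y ∈ J → J ∩ nb G x ⊆ A) :
    ∑ J ∈ F, (J ∩ far G x).card ≤ m * (bad G m x).card := by
  have h := sum_card_bipartiteAbove_eq_sum_card_bipartiteBelow
    (s := F) (t := far G x) (fun J y => y ∈ J)
  have h' := sum_card_bipartiteAbove_eq_sum_card_bipartiteBelow
    (s := bad G m x) (t := far G x) (fun J y => y ∈ J)
  simp only [bipartiteAbove, bipartiteBelow, filter_mem_eq_inter] at h h'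
  have e1 : ∑ J ∈ F, (J ∩ far G x).card = ∑ J ∈ F, (far G x ∩ J).card := by
    simp_rw [inter_comm]
  have e2 : ∑ W ∈ bad G m x, (far G x ∩ W).card = m * (bad G m x).card := by
    rw [sum_congr rfl (g := fun _ => m), sum_const, smul_eq_mul, mul_comm]
    intro W hW
    rw [inter_eq_right.2 (mem_bad.1 hW).1.1, (mem_bad.1 hW).1.2]
  rw [e1, ← e2, h, h']
  refine sum_le_sum fun y hy => ?_
  by_cases hex : ∃ J ∈ F, y ∈ J
  · obtain ⟨A, hAn, hAc, hAJ⟩ := hA y hy hex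
    refine (card_le_card_bad_filter (m := m) hy hAn hAc (fun _ => True) _ ?_).trans
      (card_le_card ?_)
    · intro J hJ
      obtain ⟨hJF, hyJ⟩ := mem_filter.1 hJ
      obtain ⟨h1, h2, h3, ⟨a, ha⟩, h5⟩ := mem_mixed.1 (hF hJF)
      refine ⟨h1, hyJ, ?_, h2.mono inter_subset_left, ⟨a, ?_⟩, trivial⟩
      · intro v hv
        rcases mem_union.1 (h3 hv) with hv' | hv'
        · exact mem_union_left _ (hAJ J hJF hyJ (mem_inter.2 ⟨hv, hv'⟩))
        · exact mem_union_right _ hv'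
      · exact mem_inter.2 ⟨(mem_inter.1 ha).1, hAJ J hJF hyJ ha⟩
    · intro W hW
      simp only [mem_filter] at hW ⊢
      exact ⟨hW.1, hW.2.1⟩
  · have : (F.filter fun J => y ∈ J) = ∅ := by
      rw [filter_eq_empty_iff]; intro J hJ hy; exact hex ⟨J, hJ, hy⟩
    rw [this]; simp

/-! ### Centres: the excess in the case `l = m + 1` -/

/-- The vertices `z` of `W` chosen by `c` from `W \ N(z)`, an independent subset of `Y`. -/
noncomputable def centres (G : SimpleGraph V) (Y : Finset V) (c : Finset V → V)
    (W : Finset V) : Finset V :=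
  W.filter fun z => Indep G (W \ nb G z) ∧ W \ nb G z ⊆ Y ∧ c (W \ nb G z) = z

/-- Exchange `J` only at y = c(J ∩ far x). The resulting `W` has W \ N(y) = J ∩ far x, so `y` is a
centre of `W`. -/
lemma card_mixed_filter_le {l : ℕ} (hdeg : ∀ v, l ≤ (nb G v).card)
    (hx : (nb G x).card ≤ l) (Y : Finset V) (c : Finset V → V)
    (hc : ∀ T : Finset V, T.Nonempty → c T ∈ T) :
    ((mixed G m x).filter fun J => J ∩ far G x ⊆ Y).card ≤
      ∑ W ∈ bad G m x, (centres G Y c W).card := by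
  set F := (mixed G m x).filter fun J => J ∩ far G x ⊆ Y
  have h0 : F.card = ∑ y ∈ far G x, (F.filter fun J => c (J ∩ far G x) = y).card := by
    refine card_eq_sum_card_fiberwise fun J hJ => ?_
    have := (mem_mixed.1 (mem_filter.1 hJ).1).2.2.2.2
    exact (mem_inter.1 (hc _ this)).2
  have h' := sum_card_bipartiteAbove_eq_sum_card_bipartiteBelow
    (s := bad G m x) (t := far G x)
    (fun W z => z ∈ W ∧ Indep G (W \ nb G z) ∧ W \ nb G z ⊆ Y ∧ c (W \ nb G z) = z)
  simp only [bipartiteAbove, bipartiteBelow] at h'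
  have e2 : ∑ W ∈ bad G m x, (centres G Y c W).card =
      ∑ W ∈ bad G m x, ((far G x).filter fun z => z ∈ W ∧ Indep G (W \ nb G z) ∧
        W \ nb G z ⊆ Y ∧ c (W \ nb G z) = z).card := by
    refine sum_congr rfl fun W hW => ?_
    congr 1
    ext z
    simp only [centres, mem_filter]
    constructor
    · rintro ⟨a, b⟩; exact ⟨(mem_bad.1 hW).1.1 a, a, b⟩
    · rintro ⟨-, a, b⟩; exact ⟨a, b⟩
  rw [h0, e2, h']
  refine sum_le_sum fun y hy => ?_
  refine (card_le_card_bad_filter (m := m) hy (A := nb G x \ nb G y) sdiff_subset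
    (card_nb_sdiff_le (c := 0) hy (hdeg y) hx) (fun T => T ⊆ Y ∧ c T = y) _ ?_).trans_eq
    (by congr)
  intro J hJ
  obtain ⟨hJF, hcJ⟩ := mem_filter.1 hJ
  obtain ⟨hJm, hJY⟩ := mem_filter.1 hJF
  obtain ⟨h1, h2, h3, ⟨a, ha⟩, h5⟩ := mem_mixed.1 hJm
  have hyJ : y ∈ J := by
    have := hc _ h5
    rw [hcJ] at this
    exact (mem_inter.1 this).1
  refine ⟨h1, hyJ, ?_, h2.mono inter_subset_left, ⟨a, ?_⟩, hJY, hcJ⟩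
  · intro v hv
    rcases mem_union.1 (h3 hv) with hv' | hv'
    · exact mem_union_left _ (mem_sdiff.2 ⟨hv', fun h => h2 y hyJ v hv (mem_nb.1 h)⟩)
    · exact mem_union_right _ hv'
  · obtain ⟨ha1, ha2⟩ := mem_inter.1 ha
    exact mem_inter.2 ⟨ha1, mem_sdiff.2 ⟨ha2, fun h => h2 y hyJ a ha1 (mem_nb.1 h)⟩⟩

lemma eq_of_mem_swaps {W : Finset V} {b r z : V} (hr : r ∈ swaps G W b) (hz : z ∈ W)
    (hbz : G.Adj b z) : r = z := by
  by_contra h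
  exact (mem_filter.1 hr).2 b (mem_insert_self _ _) z
    (mem_insert_of_mem (mem_erase.2 ⟨Ne.symm h, hz⟩)) hbz

/-- For non-adjacent centres, independence makes W \ N(z) and W \ N(z') contain each other, and `c`
picks a single vertex from a single set. -/
lemma adj_of_mem_centres {Y W : Finset V} {c : Finset V → V} {z z' : V}
    (hz : z ∈ centres G Y c W) (hz' : z' ∈ centres G Y c W) (hne : z ≠ z') : G.Adj z z' := by
  by_contra hadj
  simp only [centres, mem_filter] at hz hz'
  obtain ⟨hzW, hzi, -, hzc⟩ := hz
  obtain ⟨hzW', hzi', -, hzc'⟩ := hz'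
  have key : ∀ p q : V, q ∈ W → Indep G (W \ nb G p) → ¬ G.Adj p q →
      W \ nb G p ⊆ W \ nb G q := by
    intro p q hq hi hpq a ha
    refine mem_sdiff.2 ⟨(mem_sdiff.1 ha).1, fun h => ?_⟩
    exact hi q (mem_sdiff.2 ⟨hq, by simpa using hpq⟩) a ha (mem_nb.1 h)
  have h := (key z z' hzW' hzi hadj).antisymm (key z' z hzW hzi' fun h => hadj h.symm)
  exact hne (by rw [← hzc, h, hzc'])

/-- Centres use up the slack left by swaps. With at most two centres, each has at least two
neighbours in far x \ W, as at most m - 1 lie in W; and each b there has at most two adjacent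
centres and swaps together. Three centres form a triangle, which rules out swaps, and |Y| bounds
their number. -/
lemma two_mul_card_centres_add_le (hdeg : ∀ v, m + 1 ≤ (nb G v).card) {W : Finset V}
    (hW : W ∈ bad G m x) {Y : Finset V} (hY : ∀ z ∈ Y, nb G z ⊆ far G x)
    (hYc : Y.card + m ≤ (far G x).card) (c : Finset V → V) :
    2 * (centres G Y c W).card + ∑ b ∈ far G x \ W, (swaps G W b).card ≤
      2 * (far G x \ W).card := by
  set Q := centres G Y c W with hQ
  obtain ⟨⟨hWf, hWm⟩, hWi⟩ := mem_bad.1 hW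
  have hQW : Q ⊆ W := filter_subset _ _
  have hQY : Q ⊆ Y := by
    intro z hz
    simp only [hQ, centres, mem_filter] at hz
    exact hz.2.2.1 (mem_sdiff.2 ⟨hz.1, by simp⟩)
  have hB : (far G x \ W).card = (far G x).card - m := by
    rw [card_sdiff_of_subset hWf, hWm]
  rcases le_or_gt Q.card 2 with h2 | h3
  · have hdc := sum_card_bipartiteAbove_eq_sum_card_bipartiteBelow
      (s := Q) (t := far G x \ W) (fun z b => G.Adj b z)
    simp only [bipartiteAbove, bipartiteBelow] at hdc
    have hlow : Q.card * 2 ≤ ∑ z ∈ Q, ((far G x \ W).filter fun b => G.Adj b z).card := by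
      rw [← smul_eq_mul]
      refine card_nsmul_le_sum _ _ _ fun z hz => ?_
      have h1 : nb G z ⊆ ((far G x \ W).filter fun b => G.Adj b z) ∪ W.erase z := by
        intro a ha
        have haf := hY z (hQY hz) ha
        rw [mem_nb] at ha
        by_cases haW : a ∈ W
        · exact mem_union_right _ (mem_erase.2 ⟨ha.ne', haW⟩)
        · exact mem_union_left _ (mem_filter.2 ⟨mem_sdiff.2 ⟨haf, haW⟩, ha.symm⟩)
      have h2 := (card_le_card h1).trans (card_union_le _ _)
      have h3 := card_erase_add_one (hQW hz)
      have := hdeg z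
      omega
    have hup : ∀ b ∈ far G x \ W,
        (Q.filter fun z => G.Adj b z).card + (swaps G W b).card ≤ 2 := by
      intro b _
      rcases (Q.filter fun z => G.Adj b z).eq_empty_or_nonempty with h | ⟨z, hz⟩
      · rw [h, card_empty, zero_add]; exact card_swaps_le_two hWi b
      · obtain ⟨hzQ, hbz⟩ := mem_filter.1 hz
        have hs : swaps G W b ⊆ {z} := fun r hr =>
          mem_singleton.2 (eq_of_mem_swaps hr (hQW hzQ) hbz)
        rcases le_or_gt (Q.filter fun z => G.Adj b z).card 1 with h1 | h1
        · have := card_le_card hs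
          rw [card_singleton] at this
          omega
        · obtain ⟨z', hz', hne⟩ := exists_mem_ne h1 z
          obtain ⟨hzQ', hbz'⟩ := mem_filter.1 hz'
          have : swaps G W b = ∅ := by
            refine eq_empty_of_forall_notMem fun r hr => hne ?_
            rw [← eq_of_mem_swaps hr (hQW hzQ) hbz, eq_of_mem_swaps hr (hQW hzQ') hbz']
          rw [this, card_empty, add_zero]
          exact (card_filter_le _ _).trans h2
    have hsum := sum_le_card_nsmul _ _ _ hup
    rw [sum_add_distrib, ← hdc, smul_eq_mul] at hsum
    omega
  · have h0 : ∀ b ∈ far G x \ W, (swaps G W b).card = 0 := by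
      intro b _
      rw [card_eq_zero]
      refine eq_empty_of_forall_notMem fun r hr => ?_
      have hcard : 1 < (Q.erase r).card := by
        have := pred_card_le_card_erase (s := Q) (a := r)
        omega
      obtain ⟨p, hp, q, hq, hpq⟩ := one_lt_card.1 hcard
      have hadj := adj_of_mem_centres (mem_of_mem_erase hp) (mem_of_mem_erase hq) hpq
      exact (mem_filter.1 hr).2 p (mem_insert_of_mem (erase_subset_erase r hQW hp)) q
        (mem_insert_of_mem (erase_subset_erase r hQW hq)) hadj
    rw [sum_eq_zero h0, hB]
    have := card_le_card hQY
    omega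

lemma card_inter_add_card_inter {J : Finset V} (hJ : J ⊆ nb G x ∪ far G x) :
    (J ∩ nb G x).card + (J ∩ far G x).card = J.card := by
  rw [← card_union_of_disjoint, ← inter_union_distrib_left, inter_eq_left.2 hJ]
  rw [disjoint_left]
  intro a ha hb
  simp only [mem_inter, mem_nb, mem_far] at ha hb
  exact hb.2.2 ha.2

lemma sum_card_mixed_inter_le {l : ℕ} (hdeg : ∀ v, l ≤ (nb G v).card)
    (hx : (nb G x).card ≤ l) :
    ∑ J ∈ mixed G m x, (J ∩ far G x).card ≤ m * (bad G m x).card := by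
  refine sum_card_inter_far_le subset_rfl fun y hy _ => ⟨nb G x \ nb G y, sdiff_subset,
    card_nb_sdiff_le (c := 0) hy (hdeg y) hx, fun J hJ hyJ a ha => ?_⟩
  obtain ⟨ha1, ha2⟩ := mem_inter.1 ha
  exact mem_sdiff.2 ⟨ha2, fun h => (mem_mixed.1 hJ).2.1 y hyJ a ha1 (mem_nb.1 h)⟩

lemma card_extenders_add_le (J : Finset V) :
    (extenders G x J).card + (J ∩ nb G x).card ≤ (nb G x).card := by
  rw [← card_union_of_disjoint]
  · exact card_le_card (union_subset (filter_subset _ _) inter_subset_right)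
  · rw [disjoint_left]
    intro a ha hb
    exact (mem_filter.1 ha).2.1 (mem_inter.1 hb).1

lemma card_extenders_add_lt {J : Finset V} (hJ : Indep G J) {v w : V} (hv : v ∈ J)
    (hw : w ∈ nb G x) (hvw : G.Adj v w) :
    (extenders G x J).card + (J ∩ nb G x).card < (nb G x).card := by
  rw [← card_union_of_disjoint]
  · refine card_lt_card (ssubset_iff_of_subset
      (union_subset (filter_subset _ _) inter_subset_right) |>.2 ⟨w, hw, fun h => ?_⟩)
    rcases mem_union.1 h with h | h
    · exact (mem_filter.1 h).2.2 v (mem_insert_of_mem hv) w (mem_insert_self _ _) hvw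
    · exact hJ v hv w (mem_inter.1 h).1 hvw
  · rw [disjoint_left]
    intro a ha hb
    exact (mem_filter.1 ha).2.1 (mem_inter.1 hb).1

/-! ### Links of the neighbours of `x` -/

lemma two_mul_sum_card_extenders_good_le {l : ℕ} (hdeg : ∀ v, l ≤ (nb G v).card)
    (hx : (nb G x).card ≤ l) (hm : 2 ≤ m) :
    2 * ∑ T ∈ good G m x, (extenders G x T).card ≤
      ∑ W ∈ bad G m x, ∑ b ∈ far G x \ W, (swaps G W b).card := by
  refine le_trans ?_ (sum_card_reach_le G m x)
  rw [mul_sum]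
  refine sum_le_sum fun T hT => ?_
  calc 2 * (extenders G x T).card ≤ m * (extenders G x T).card := Nat.mul_le_mul_right _ hm
    _ = T.card • (extenders G x T).card := by rw [(mem_good.1 hT).1.2, smul_eq_mul]
    _ ≤ _ := card_nsmul_le_sum _ _ _ fun b hb =>
        card_extenders_le (c := 0) hdeg hx hm hT hb

/-- Good sets cost at most |far x \ W| per bad `W`, mixed sets at most `m`, and these add up to |far
x|. For l = m + 1 a mixed set may have one extender too many; centres absorb this. -/
lemma sum_card_extenders_le {l : ℕ} (hdeg : ∀ v, l ≤ (nb G v).card)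
    (hx : (nb G x).card = l) (hm : 2 ≤ m) (hlm : l ≤ m + 1) (hn : 2 * l ≤ Fintype.card V) :
    ∑ T ∈ good G m x, (extenders G x T).card + ∑ J ∈ mixed G m x, (extenders G x J).card ≤
      (far G x).card * (bad G m x).card := by
  have hfar := card_far_add (G := G) x
  have h1 := two_mul_sum_card_extenders_good_le hdeg hx.le hm
  have h2 := sum_card_mixed_inter_le (m := m) hdeg hx.le
  have hB : ∀ W ∈ bad G m x, (far G x \ W).card + m = (far G x).card := by
    intro W hW
    have := card_sdiff_add_card_eq_card (mem_bad.1 hW).1.1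
    rwa [(mem_bad.1 hW).1.2] at this
  have hBsum : ∑ W ∈ bad G m x, (far G x \ W).card + m * (bad G m x).card =
      (far G x).card * (bad G m x).card := by
    rw [mul_comm m, mul_comm (far G x).card, ← smul_eq_mul, ← smul_eq_mul, ← sum_const,
      ← sum_const, ← sum_add_distrib]
    exact sum_congr rfl hB
  rcases Nat.lt_or_ge m l with hml | hlm'
  · have hl : l = m + 1 := by omega
    subst hl
    obtain ⟨c, hc⟩ : ∃ c : Finset V → V, ∀ T : Finset V, T.Nonempty → c T ∈ T :=
      ⟨fun T => if h : T.Nonempty then h.choose else x, fun T hT => by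
        simp only [hT, dif_pos]; exact hT.choose_spec⟩
    -- When an excess occurs, no vertex of `J` has a neighbour in N(x). The guard records a vertex
    -- of J ∩ N(x) as witness; its neighbours lie outside Y, which keeps Y small.
    set Y : Finset V := if ∃ u ∈ nb G x, ∀ w, G.Adj u w → ¬ G.Adj x w then
      (far G x).filter fun z => nb G z ⊆ far G x else ∅ with hYdef
    have hY : ∀ z ∈ Y, nb G z ⊆ far G x := by
      intro z hz
      rw [hYdef] at hz
      split_ifs at hz
      · exact (mem_filter.1 hz).2
      · simp at hz
    have hYf : Y ⊆ far G x := by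
      rw [hYdef]; split_ifs <;> simp [filter_subset]
    have hYc : Y.card + m ≤ (far G x).card := by
      by_cases hu : ∃ u ∈ nb G x, ∀ w, G.Adj u w → ¬ G.Adj x w
      · obtain ⟨u, hux, hu⟩ := hu
        have hs : nb G u ⊆ insert x (far G x \ Y) := by
          intro w hw
          rw [mem_nb] at hw
          by_cases hwx : w = x
          · simp [hwx]
          · refine mem_insert_of_mem (mem_sdiff.2 ⟨mem_far.2 ⟨hwx, hu w hw⟩, fun hwY => ?_⟩)
            exact (mem_far.1 (hY w hwY (mem_nb.2 hw.symm))).2 (mem_nb.1 hux)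
        have h3 := (card_le_card hs).trans (card_insert_le _ _)
        rw [card_sdiff_of_subset hYf] at h3
        have := hdeg u
        have := card_le_card hYf
        omega
      · have : Y = ∅ := by rw [hYdef, if_neg hu]
        rw [this, card_empty]
        omega
    have hext : ∀ J ∈ mixed G m x, (extenders G x J).card ≤
        (J ∩ far G x).card + if J ∩ far G x ⊆ Y then 1 else 0 := by
      intro J hJ
      obtain ⟨hJm, hJi, hJs, ⟨v, hv⟩, hJf⟩ := mem_mixed.1 hJ
      have hsplit := card_inter_add_card_inter hJs
      have hadd := card_extenders_add_le (G := G) (x := x) J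
      by_cases hex : ∃ z ∈ J, ∃ w ∈ nb G x, G.Adj z w
      · obtain ⟨z, hz, w, hw, hzw⟩ := hex
        have := card_extenders_add_lt hJi hz hw hzw
        omega
      · push Not at hex
        obtain ⟨hvJ, hvx⟩ := mem_inter.1 hv
        have hu : ∃ u ∈ nb G x, ∀ w, G.Adj u w → ¬ G.Adj x w :=
          ⟨v, hvx, fun w hw hxw => hex v hvJ w (mem_nb.2 hxw) hw⟩
        have hsub : J ∩ far G x ⊆ Y := by
          rw [hYdef, if_pos hu]
          intro z hz
          obtain ⟨hzJ, hzf⟩ := mem_inter.1 hz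
          refine mem_filter.2 ⟨hzf, fun w hw => ?_⟩
          rw [mem_nb] at hw
          refine mem_far.2 ⟨fun h => (mem_far.1 hzf).2 (h ▸ hw.symm), fun h => ?_⟩
          exact hex z hzJ w (mem_nb.2 h) hw
        rw [if_pos hsub]
        omega
    have h3 := sum_le_sum hext
    rw [sum_add_distrib, ← card_filter] at h3
    have h4 := card_mixed_filter_le (m := m) hdeg hx.le Y c hc
    have h5 := sum_le_sum fun W (hW : W ∈ bad G m x) =>
      two_mul_card_centres_add_le hdeg hW hY hYc c
    rw [sum_add_distrib, ← mul_sum, ← mul_sum] at h5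
    omega
  · have hext : ∀ J ∈ mixed G m x, (extenders G x J).card ≤ (J ∩ far G x).card := by
      intro J hJ
      obtain ⟨hJm, hJi, hJs, -⟩ := mem_mixed.1 hJ
      have := card_inter_add_card_inter hJs
      have := card_extenders_add_le (G := G) (x := x) J
      omega
    have h3 := sum_le_sum hext
    have h5 : ∑ W ∈ bad G m x, ∑ b ∈ far G x \ W, (swaps G W b).card ≤
        ∑ W ∈ bad G m x, 2 * (far G x \ W).card := by
      refine sum_le_sum fun W hW => ?_
      rw [mul_comm, ← smul_eq_mul]
      exact sum_le_card_nsmul _ _ _ fun b _ => card_swaps_le_two (mem_bad.1 hW).2 b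
    rw [← mul_sum] at h5
    omega

lemma card_link_filter_nb_le {u : V} (hu : u ∈ nb G x) :
    ((link G m u).filter fun J => J ⊆ nb G x).card ≤ ((nb G x).card - 1).choose m := by
  rw [← card_erase_of_mem hu, ← card_powersetCard]
  refine card_le_card fun J hJ => ?_
  obtain ⟨h1, h2⟩ := mem_filter.1 hJ
  obtain ⟨h3, h4, -⟩ := mem_link.1 h1
  exact mem_powersetCard.2 ⟨fun a ha => mem_erase.2 ⟨fun h => h4 (h ▸ ha), h2 ha⟩, h3⟩

lemma sum_card_link_nb_le :
    ∑ u ∈ nb G x, (link G m u).card ≤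
      ∑ T ∈ good G m x, (extenders G x T).card +
      ∑ u ∈ nb G x, ((link G m u).filter fun J => J ⊆ nb G x).card +
      ∑ J ∈ mixed G m x, (extenders G x J).card := by
  rw [← sum_card_link_filter_far, ← sum_card_mixed_filter, ← sum_add_distrib,
    ← sum_add_distrib]
  exact sum_le_sum fun u hu => card_link_le (mem_nb.1 hu)

/-- Here deg x exceeds the minimum degree bound by one, so each comparison of degrees loses one;
only the terms without the factor |bad| need care. -/
lemma sum_card_link_nb_le_of_card_eq_add_two (hdeg : ∀ v, m + 1 ≤ (nb G v).card)
    (hx : (nb G x).card = m + 2) (hm : 2 ≤ m) :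
    ∑ u ∈ nb G x, (link G m u).card ≤ (good G m x).card +
      (m * (m + 2) + (far G x).card * m) * (bad G m x).card + (m + 2) * (m + 1) := by
  have h0 : ∑ u ∈ nb G x, ((link G m u).filter fun J => J ⊆ nb G x).card ≤
      (m + 2) * (m + 1) := by
    rw [← hx, ← smul_eq_mul]
    refine sum_le_card_nsmul _ _ _ fun u hu => (card_link_filter_nb_le hu).trans_eq ?_
    rw [hx, Nat.add_sub_assoc (by norm_num)]
    exact Nat.choose_succ_self_right m
  have h1 : ∑ T ∈ good G m x, (extenders G x T).card ≤
      (good G m x).card + (far G x).card * m * (bad G m x).card := by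
    have e1 : ∑ T ∈ good G m x, (extenders G x T).card ≤
        ∑ T ∈ good G m x, (1 + ∑ b ∈ T, (reach G x T b).card) := by
      refine sum_le_sum fun T hT => ?_
      obtain ⟨b, hb⟩ : T.Nonempty := by
        rw [← card_pos, (mem_good.1 hT).1.2]; omega
      have := card_extenders_le (c := 1) hdeg hx.le hm hT hb
      have := single_le_sum (f := fun b => (reach G x T b).card)
        (fun _ _ => Nat.zero_le _) hb
      omega
    have e2 := sum_card_reach_le G m x
    have e3 : ∑ W ∈ bad G m x, ∑ b ∈ far G x \ W, (swaps G W b).card ≤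
        (bad G m x).card * ((far G x).card * m) := by
      rw [← smul_eq_mul]
      refine sum_le_card_nsmul _ _ _ fun W hW => ?_
      calc ∑ b ∈ far G x \ W, (swaps G W b).card ≤ (far G x \ W).card • m :=
            sum_le_card_nsmul _ _ _ fun b _ =>
              (card_filter_le _ _).trans_eq (mem_bad.1 hW).1.2
        _ ≤ _ := Nat.mul_le_mul_right _ (card_le_card sdiff_subset)
    rw [sum_add_distrib, sum_const, smul_eq_mul, mul_one] at e1
    rw [mul_comm (_ * m)]
    omega
  have h2 : ∑ J ∈ mixed G m x, (extenders G x J).card ≤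
      m * (m + 2) * (bad G m x).card := by
    rw [← sum_card_mixed_filter]
    have : m * (m + 2) * (bad G m x).card = (nb G x).card • (m * (bad G m x).card) := by
      rw [hx, smul_eq_mul]; ring
    rw [this]
    refine sum_le_card_nsmul _ _ _ fun u hu => ?_
    set F := (mixed G m x).filter fun J => u ∉ J ∧ Indep G (insert u J)
    have hF : F ⊆ mixed G m x := filter_subset _ _
    calc F.card = ∑ J ∈ F, 1 := by simp
      _ ≤ ∑ J ∈ F, (J ∩ far G x).card :=
          sum_le_sum fun J hJ => card_pos.2 (mem_mixed.1 (hF hJ)).2.2.2.2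
      _ ≤ _ := ?_
    refine sum_card_inter_far_le hF fun y hy hex => ?_
    obtain ⟨K, hK, hyK⟩ := hex
    have huy : ¬ G.Adj y u := (mem_filter.1 hK).2.2 y (mem_insert_of_mem hyK) u
      (mem_insert_self _ _)
    -- `u` is non-adjacent to `y` and never used by `J`; omitting it recovers the one place lost.
    refine ⟨(nb G x \ nb G y).erase u, (erase_subset _ _).trans sdiff_subset, ?_, ?_⟩
    · have h3 := card_nb_sdiff_le (c := 1) hy (hdeg y) hx.le
      have h4 := card_erase_add_one (s := nb G x \ nb G y) (a := u)
        (mem_sdiff.2 ⟨hu, fun h => huy (mem_nb.1 h)⟩)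
      omega
    · intro J hJ hyJ a ha
      obtain ⟨ha1, ha2⟩ := mem_inter.1 ha
      refine mem_erase.2 ⟨fun h => (mem_filter.1 hJ).2.1 (h ▸ ha1), mem_sdiff.2 ⟨ha2, ?_⟩⟩
      exact fun h => (mem_mixed.1 (hF hJ)).2.1 y hyJ a ha1 (mem_nb.1 h)
  have h3 := sum_card_link_nb_le (G := G) (m := m) (x := x)
  rw [add_mul]
  omega

/-! ### Binomial estimates -/

lemma add_one_mul_choose_add_one_le (a k : ℕ) :
    (k + 1) * a.choose (k + 1) ≤ a * a.choose k := by
  rw [mul_comm, Nat.choose_succ_right_eq, mul_comm]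
  exact Nat.mul_le_mul_right _ (Nat.sub_le _ _)

lemma add_one_mul_choose_add_one_add {a k : ℕ} (hk : k ≤ a) :
    (k + 1) * a.choose (k + 1) + (k + 1) * a.choose k = (a + 1) * a.choose k := by
  have h := Nat.choose_succ_right_eq a k
  obtain ⟨d, rfl⟩ := Nat.exists_eq_add_of_le hk
  rw [Nat.add_sub_cancel_left] at h
  nlinarith

lemma add_two_mul_choose_le {a l m : ℕ} (hl : l ≤ m) (hm : 1 ≤ m) :
    (a + l + 2) * a.choose m ≤ (a + 2) * (a + 1).choose m := by
  obtain ⟨k, rfl⟩ := Nat.exists_eq_add_of_le' hm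
  have h := add_one_mul_choose_add_one_le a k
  rw [Nat.choose_succ_succ' a k]
  nlinarith [Nat.mul_le_mul_right (a.choose (k + 1)) hl]

lemma add_four_mul_choose_le {a m : ℕ} (hm : 2 ≤ m) :
    (a + m + 4) * a.choose m ≤ (a + 3) * (a + 2).choose m := by
  obtain ⟨k, rfl⟩ := Nat.exists_eq_add_of_le' hm
  have h := add_one_mul_choose_add_one_le a (k + 1)
  rw [Nat.choose_succ_succ' (a + 1) (k + 1), Nat.choose_succ_succ' a (k + 1),
    Nat.choose_succ_succ' a k]
  nlinarith [Nat.zero_le (a.choose k), Nat.zero_le (a.choose (k + 1)),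
    Nat.zero_le (k * a.choose (k + 2))]

/-! ### The two bounds by C(n-l, t) -/

lemma sum_card_link_le {F : ℕ} (hF : ∀ v, (link G m v).card ≤ F) :
    ∑ v, (link G m v).card ≤
      ((far G x).card + 1) * F + ∑ u ∈ nb G x, (link G m u).card := by
  rw [← sum_add_sum_compl (nb G x), add_comm]
  gcongr
  rw [← smul_eq_mul]
  refine (sum_le_card_nsmul _ _ _ fun v _ => hF v).trans_eq ?_
  rw [card_compl]
  have := card_far_add (G := G) x
  congr 1
  omega

/-- As m ≥ 2, an edge inside far x would extend to a bad set, so N(x) and its complement are the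
colour classes. -/
lemma colorable_two_of_bad_eq_empty (hm : 2 ≤ m) (hfar : m ≤ (far G x).card)
    (hbad : bad G m x = ∅) (hnb : Indep G (nb G x)) : G.Colorable 2 := by
  have hfi : Indep G (far G x) := by
    intro p hp q hq hpq
    have hs : ({p, q} : Finset V) ⊆ far G x := by
      intro a ha
      rcases mem_insert.1 ha with rfl | ha
      · exact hp
      · rw [mem_singleton.1 ha]; exact hq
    obtain ⟨W, h1, h2, h3⟩ := exists_subsuperset_card_eq hs (card_le_two.trans hm) hfar
    have : W ∈ bad G m x := mem_bad.2 ⟨⟨h2, h3⟩, fun h =>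
      h p (h1 (by simp)) q (h1 (by simp)) hpq⟩
    simp [hbad] at this
  have C : G.Coloring Bool := SimpleGraph.Coloring.mk (fun v => decide (v ∈ nb G x)) (by
    intro v w hvw h
    simp only [decide_eq_decide] at h
    by_cases hv : v ∈ nb G x
    · exact hnb v hv w (h.1 hv) hvw
    · have hw : w ∉ nb G x := fun hw => hv (h.2 hw)
      rw [mem_nb] at hv hw
      have hvx : v ≠ x := fun e => hw (e ▸ hvw)
      have hwx : w ≠ x := fun e => hv (e ▸ hvw.symm)
      exact hfi v (mem_far.2 ⟨hvx, hv⟩) w (mem_far.2 ⟨hwx, hw⟩) hvw)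
  simpa using C.colorable

/-- A graph of minimum degree at least `l` has at most `C(n - l, t)` independent sets of size
`t > l`. -/
theorem card_indep_le_choose_of_lt {l : ℕ} (hdeg : ∀ v, l ≤ (nb G v).card) (hm : 2 ≤ m)
    (hlm : l ≤ m) (hn : 2 * l ≤ Fintype.card V) :
    (univ.filter fun I : Finset V => I.card = m + 1 ∧ Indep G I).card ≤
      (Fintype.card V - l).choose (m + 1) := by
  rcases isEmpty_or_nonempty V with hV | hV
  · have : (univ.filter fun I : Finset V => I.card = m + 1 ∧ Indep G I) = ∅ := by
      rw [filter_eq_empty_iff]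
      rintro I - ⟨h, -⟩
      rw [Finset.eq_empty_of_isEmpty I] at h
      simp at h
    rw [this]; simp
  obtain ⟨x, -, hmax⟩ := exists_max_image (univ : Finset V) (fun v => (link G m v).card)
    univ_nonempty
  have hF : ∀ v, (link G m v).card ≤ (good G m x).card := fun v => by
    rw [← link_eq_good]; exact hmax v (mem_univ v)
  have hsum := sum_card_link G m
  have hfar := card_far_add (G := G) x
  have hgb := card_good_add_card_bad (G := G) m x
  have hpos : 0 < m + 1 := by omega
  refine Nat.le_of_mul_le_mul_left ?_ hpos
  rw [← hsum]
  rcases (hdeg x).eq_or_lt with hx | hx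
  · have h1 := sum_card_link_le (x := x) hF
    have h2 := sum_card_link_nb_le (G := G) (m := m) (x := x)
    have h3 := sum_card_extenders_le hdeg hx.symm hm (by omega) hn
    have h4 : ∑ u ∈ nb G x, ((link G m u).filter fun J => J ⊆ nb G x).card = 0 := by
      refine sum_eq_zero fun u hu => ?_
      have := card_link_filter_nb_le (m := m) hu
      rw [Nat.choose_eq_zero_of_lt (by
        have : 0 < (nb G x).card := card_pos.2 ⟨u, hu⟩
        omega)] at this
      omega
    have hnl : Fintype.card V - l = (far G x).card + 1 := by omega
    rw [hnl, mul_comm (m + 1), ← Nat.add_one_mul_choose_eq, ← hgb]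
    nlinarith
  · have h1 : ∑ v, (link G m v).card ≤ Fintype.card V * (good G m x).card := by
      rw [← card_univ, ← smul_eq_mul]
      exact sum_le_card_nsmul _ _ _ fun v _ => hF v
    obtain ⟨a, ha⟩ : ∃ a, Fintype.card V = a + l + 2 :=
      ⟨Fintype.card V - (l + 2), by omega⟩
    have h2 : (good G m x).card ≤ a.choose m :=
      (Nat.le.intro hgb).trans (Nat.choose_le_choose m (by omega))
    have hnl : Fintype.card V - l = a + 2 := by omega
    rw [hnl, mul_comm (m + 1), ← Nat.add_one_mul_choose_eq]
    calc _ ≤ _ := h1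
      _ ≤ (a + l + 2) * a.choose m := by rw [ha]; exact Nat.mul_le_mul_left _ h2
      _ ≤ _ := add_two_mul_choose_le hlm (by omega)

/-- A graph of minimum degree at least `l ≥ 3` that is not bipartite has at most `C(n - l, l)`
independent sets of size `l`. -/
theorem card_indep_le_choose_of_not_colorable (hdeg : ∀ v, m + 1 ≤ (nb G v).card)
    (hm : 2 ≤ m) (hn : 2 * (m + 1) ≤ Fintype.card V) (hcol : ¬ G.Colorable 2) :
    (univ.filter fun I : Finset V => I.card = m + 1 ∧ Indep G I).card ≤
      (Fintype.card V - (m + 1)).choose (m + 1) := by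
  have hV : Nonempty V := Fintype.card_pos_iff.1 (by omega)
  obtain ⟨x, -, hmax⟩ := exists_max_image (univ : Finset V) (fun v => (link G m v).card)
    univ_nonempty
  have hF : ∀ v, (link G m v).card ≤ (good G m x).card := fun v => by
    rw [← link_eq_good]; exact hmax v (mem_univ v)
  have hsum := sum_card_link G m
  have hfar := card_far_add (G := G) x
  have hgb := card_good_add_card_bad (G := G) m x
  have hpos : 0 < m + 1 := by omega
  have hall : ∑ v, (link G m v).card ≤ Fintype.card V * (good G m x).card := by
    rw [← card_univ, ← smul_eq_mul]
    exact sum_le_card_nsmul _ _ _ fun v _ => hF v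
  have h1 := sum_card_link_le (x := x) hF
  -- Counts are integers, so an error below m + 1 in the multiplied inequality is harmless.
  refine Nat.le_of_lt_succ (Nat.lt_of_mul_lt_mul_left (a := m + 1) ?_)
  rw [← hsum, Nat.succ_eq_add_one, mul_add, mul_one]
  rcases (hdeg x).eq_or_lt with hx | hx
  · have h2 := sum_card_link_nb_le (G := G) (m := m) (x := x)
    have h3 := sum_card_extenders_le hdeg hx.symm hm le_rfl hn
    have hnl : Fintype.card V - (m + 1) = (far G x).card + 1 := by omega
    rw [hnl, mul_comm (m + 1), ← Nat.add_one_mul_choose_eq, ← hgb]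
    rcases (bad G m x).eq_empty_or_nonempty with hb | hb
    · have h4 : ∑ u ∈ nb G x, ((link G m u).filter fun J => J ⊆ nb G x).card = 0 := by
        refine sum_eq_zero fun u hu => ?_
        rw [card_eq_zero, filter_eq_empty_iff]
        intro J hJ hJn
        obtain ⟨hJm, huJ, hJi⟩ := mem_link.1 hJ
        have : insert u J = nb G x := by
          refine eq_of_subset_of_card_le (insert_subset hu hJn) ?_
          rw [card_insert_of_notMem huJ]; omega
        rw [this] at hJi
        exact hcol (colorable_two_of_bad_eq_empty hm (by omega) hb hJi)
      rw [hb, card_empty] at h3 ⊢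
      nlinarith
    · have h4 : ∑ u ∈ nb G x, ((link G m u).filter fun J => J ⊆ nb G x).card ≤ m + 1 := by
        calc _ ≤ (nb G x).card • 1 := sum_le_card_nsmul _ _ _ fun u hu =>
              (card_link_filter_nb_le hu).trans_eq (by rw [← hx]; simp)
          _ = m + 1 := by rw [← hx]; simp
      have := card_pos.2 hb
      nlinarith
  rcases (Nat.succ_le_of_lt hx).eq_or_lt with hx | hx
  · have h2 := sum_card_link_nb_le_of_card_eq_add_two hdeg hx.symm hm
    set S := ∑ v, (link G m v).card
    set a := (far G x).card with ha
    have hn' : Fintype.card V = a + m + 3 := by omega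
    -- Add `m` times the bound n·g to the neighbourhood bound: the coefficient of g becomes
    -- (m+1)(a+m+2), and that of b is m(a+m+2), which is no larger.
    have hS : S ≤ (a + m + 2) * a.choose m + (m + 2) := by
      refine Nat.le_of_mul_le_mul_left ?_ hpos
      rw [hn'] at hall
      rw [← hgb]
      nlinarith [Nat.mul_le_mul_left m hall, Nat.zero_le ((bad G m x).card * a),
        Nat.zero_le ((bad G m x).card * m)]
    have hnl : Fintype.card V - (m + 1) = a + 1 + 1 := by omega
    rw [hnl, mul_comm (m + 1), ← Nat.add_one_mul_choose_eq]
    obtain ⟨k, rfl⟩ := Nat.exists_eq_add_of_le' (show 1 ≤ m by omega)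
    have h5 := add_one_mul_choose_add_one_add (a := a) (k := k) (by omega)
    have h6 : 0 < a.choose k := Nat.choose_pos (by omega)
    rw [Nat.choose_succ_succ' a k]
    nlinarith
  · obtain ⟨a, ha⟩ : ∃ a, Fintype.card V = a + m + 4 :=
      ⟨Fintype.card V - (m + 4), by omega⟩
    have h2 : (good G m x).card ≤ a.choose m :=
      (Nat.le.intro hgb).trans (Nat.choose_le_choose m (by omega))
    have hnl : Fintype.card V - (m + 1) = a + 2 + 1 := by omega
    rw [hnl, mul_comm (m + 1), ← Nat.add_one_mul_choose_eq]
    have h3 := Nat.mul_le_mul_left (a + m + 4) h2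
    have h4 := add_four_mul_choose_le (a := a) hm
    rw [ha] at hall
    have : a + 2 + 1 = a + 3 := rfl
    rw [this]
    omega

/-! ### Translation to the stated notions -/

lemma indepCount_eq (G : SimpleGraph V) (t : ℕ) :
    indepCount G t = (univ.filter fun I : Finset V => I.card = t ∧ Indep G I).card := by
  rw [indepCount, ← Set.ncard_coe_finset]
  congr 1
  ext I
  simp only [SimpleGraph.mem_indepSetSet_iff, SimpleGraph.isNIndepSet_iff, coe_filter, mem_univ,
    true_and, Set.mem_ofPred_eq]
  rw [and_comm]
  refine and_congr_right fun _ => ⟨fun h a ha b hb hab => h ha hb hab.ne hab, ?_⟩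
  exact fun h a ha b hb _ => h a ha b hb

lemma choose_le_indepCount_extremalGraph (n k l t : ℕ) :
    (n - l).choose t ≤ indepCount (extremalGraph n k l) t := by
  rw [indepCount_eq]
  calc (n - l).choose t = ((univ : Finset (Fin (n - l))).powersetCard t).card := by
        rw [card_powersetCard, card_univ, Fintype.card_fin]
    _ ≤ _ := card_le_card_of_injOn (fun s => s.map Function.Embedding.inr) ?_ ?_
  · intro s hs
    simp only [coe_filter, mem_univ, true_and, Set.mem_ofPred_eq, card_map]
    refine ⟨(mem_powersetCard.1 hs).2, fun a ha b hb => ?_⟩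
    obtain ⟨i, -, rfl⟩ := mem_map.1 ha
    obtain ⟨j, -, rfl⟩ := mem_map.1 hb
    simp [extremalGraph, join]
  · exact (map_injective _).injOn

/-- Deleting N(v) isolates `v`, and n ≥ 2l leaves another vertex behind. -/
lemma IsVertexConnected.le_card_nb {l : ℕ} (h : IsVertexConnected G l)
    (hl : 2 * l ≤ Fintype.card V) (v : V) : l ≤ (nb G v).card := by
  by_contra hlt
  rw [not_le] at hlt
  have hc := h.2 (nb G v) hlt
  have hfar := card_far_add (G := G) v
  obtain ⟨w, hw⟩ : (far G v).Nonempty := by rw [← card_pos]; omega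
  obtain ⟨hwv, hadj⟩ := mem_far.1 hw
  obtain ⟨p⟩ := hc.preconnected (⟨v, by simp⟩ : ((nb G v : Set V)ᶜ : Set V))
    (⟨w, by simpa using hadj⟩ : ((nb G v : Set V)ᶜ : Set V))
  cases p with
  | nil => exact hwv rfl
  | @cons _ b _ hb _ =>
    have := b.2
    simp only [Set.mem_compl_iff, mem_coe, mem_nb] at this
    exact this hb

end Counting
end IndepCount

theorem mainTheorem6 (k l n : ℕ) (hk : 3 ≤ k) (hl : k ≤ l) (hn : 2 * l ≤ n)
    {V : Type*} [Fintype V] (G : SimpleGraph V) (hcard : Fintype.card V = n)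
    (hchrom : G.chromaticNumber = (k : ℕ∞)) (hconn : IndepCount.IsVertexConnected G l)
    (t : ℕ) (ht : l ≤ t) :
    IndepCount.indepCount G t ≤
      IndepCount.indepCount (IndepCount.extremalGraph n k l) t := by
  subst hcard
  have hdeg := hconn.le_card_nb hn
  refine le_trans ?_ (IndepCount.choose_le_indepCount_extremalGraph _ k l t)
  rw [IndepCount.indepCount_eq]
  obtain ⟨m, rfl⟩ := Nat.exists_eq_add_of_le' (show 1 ≤ t by omega)
  -- The case t = l, the only one where k ≥ 3 has to exclude bipartite graphs, against t > l.
  rcases Nat.lt_or_ge m l with hml | hlm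
  · obtain rfl : l = m + 1 := by omega
    refine IndepCount.card_indep_le_choose_of_not_colorable hdeg (by omega) hn fun hcol => ?_
    have h := SimpleGraph.chromaticNumber_le_iff_colorable.2 hcol
    rw [hchrom] at h
    have : k ≤ 2 := by exact_mod_cast h
    omega
  · exact IndepCount.card_indep_le_choose_of_lt hdeg (by omega) hlm hn
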